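/- Fix $\beta>0$, let $b$ be a standard Brownian motion on $[0,\infty)$, and let $$\mathrm{SAO}_\beta=-\partial_t^2+t+\tfrac{2}{\sqrt\beta}\,b'$$ be the stochastic Airy operator on $L^2(\mathbb R_+)$ with Dirichlet boundary condition $f(0)=0$. Its quadratic form is $$\langle f,\mathrm{SAO}_\beta f\rangle=\int_0^\infty f'(t)^2\,dt+\int_0^\infty t\,f(t)^2\,dt+\tfrac{2}{\sqrt\beta}\int_0^\infty f(t)^2\,db(t),$$ for real functions $f$ with $f(0)=0$ and $f,\,f',\,\sqrt t\,f\in L^2(\mathbb R_+)$, where the last integral is defined path by path through integration by parts, $$\int_0^\infty f^2\,db=\lim_{R\to\infty}\Big(f(R)^2b(R)-\int_0^R 2f(t)f'(t)\,b(t)\,dt\Big).$$ The eigenvalues $\Lambda_0\le\Lambda_1\le\cdots$ of $\mathrm{SAO}_\beta$ are given by the Courant–Fischer formula $$\Lambda_k=\inf_{A:\ \dim A=k+1}\ \ \sup_{f\in A,\ \|f\|_2=1}\langle f,\mathrm{SAO}_\beta f\rangle ,$$ where $A$ runs over the subspaces of the space of such functions. Then the bottom eigenvalue $\Lambda_0$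 satisfies, as $a\to\infty$, $$P(\Lambda_0>a)\le\exp\Big(-\frac{\beta}{24}\,a^3\,(1+o(1))\Big),$$ that is, there is a function $\varepsilon_\beta:\mathbb R\to\mathbb R$ with $\varepsilon_\beta(a)\to0$ as $a\to\infty$ such that $P(\Lambda_0>a)\le\exp\big(-\frac{\beta}{24}a^3(1+\varepsilon_\beta(a))\big)$ for all $a>0$. -/

import Mathlib

open MeasureTheory ProbabilityTheory Filter Topology
open scoped NNReal

namespace StochasticAiry

noncomputable section

/-- The form domain with Dirichlet condition at `0`: functions `f` on `[0, ∞)` with `f 0 = 0`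
such that `f`, `f'` and `√t f` are in `L²(0, ∞)`. Here `f` is represented by its locally absolutely
continuous version, extended by `0` to the negative half-line. Since a function with a weak
derivative in `L²` has exactly one such version, the dimension of a space of such functions is its
dimension as a space of `L²` classes. -/
structure FormDomain (f : ℝ → ℝ) : Prop where
  eq_zero : ∀ t ≤ 0, f t = 0
  absCont : ∀ R : ℝ, 0 ≤ R → AbsolutelyContinuousOnInterval f 0 R
  memLp : MemLp f 2 (volume.restrict (Set.Ioi 0))
  memLp_deriv : MemLp (deriv f) 2 (volume.restrict (Set.Ioi 0))
  memLp_sqrt : MemLp (fun t => √t * f t) 2 (volume.restrict (Set.Ioi 0))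

/-- The squared norm `‖f‖₂²` in `L²(0, ∞)`. -/
def normSq (f : ℝ → ℝ) : ℝ := ∫ t in Set.Ioi (0 : ℝ), f t ^ 2

/-- The integral `∫₀^R f(t)² db(t)` along the path `b`, defined through integration by parts,
`f(R)² b(R) - ∫₀^R (f²)'(t) b(t) dt`. The boundary term at `0` is absent because `f 0 = 0`. -/
def noiseIntegralUpTo (b : ℝ≥0 → ℝ) (f : ℝ → ℝ) (R : ℝ) : ℝ :=
  f R ^ 2 * b R.toNNReal - ∫ t in (0 : ℝ)..R, 2 * f t * deriv f t * b t.toNNReal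

/-- The pairing `⟨f, b' f⟩ = ∫₀^∞ f² db` of the distribution `b'` with `f²`, as the limit of the
integrals over `[0, R]` as `R → ∞`. If `f` has compact support, these integrals are eventually
constant. For almost every Brownian path the limit exists for all `f` in the form domain
simultaneously: the increments `b(t + s) - b(t)`, `0 ≤ s ≤ 1`, are `O(√(log t))`, and
`f`, `f'`, `√t f` are in `L²`. -/
def noiseForm (b : ℝ≥0 → ℝ) (f : ℝ → ℝ) : ℝ :=
  limUnder atTop (noiseIntegralUpTo b f)

/-- The quadratic form `⟨f, SAO_β f⟩` of `SAO_β = -∂ₜ² + t + (2/√β) b'` for the noise path `b`. -/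
def saoForm (β : ℝ) (b : ℝ≥0 → ℝ) (f : ℝ → ℝ) : ℝ :=
  (∫ t in Set.Ioi (0 : ℝ), deriv f t ^ 2) + (∫ t in Set.Ioi (0 : ℝ), t * f t ^ 2)
    + 2 / √β * noiseForm b f

/-- The eigenvalues `Λ₀ ≤ Λ₁ ≤ ⋯` of `SAO_β` for the noise path `b`, through the Courant–Fischer
characterization: `Λ_k` is the infimum, over the `(k+1)`-dimensional subspaces `A` of the form
domain, of the supremum of `⟨f, SAO_β f⟩` over `f ∈ A` with `‖f‖₂ = 1`. Extended-real valued, so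
that the infimum and the supremum carry no convention. -/
def eigenvalue (β : ℝ) (b : ℝ≥0 → ℝ) (k : ℕ) : EReal :=
  ⨅ (A : Submodule ℝ (ℝ → ℝ)) (_ : Module.finrank ℝ A = k + 1) (_ : ∀ f ∈ A, FormDomain f),
    ⨆ (f : ℝ → ℝ) (_ : f ∈ A) (_ : normSq f = 1), (saoForm β b f : EReal)

end

end StochasticAiry

/-! If `Λ₀ > a`, then every compactly supported `f ≠ 0` in the form domain satisfies `(2/√β) ∫ f² db
> ∫ (a - t) f² - ∫ f'²` (`mul_normSq_lt_saoForm`). For a deterministic `f` the left side is a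
centred Gaussian of variance `(4/β) ∫ f⁴`, so the event has probability at most `exp(-(β/8) (∫ (a -
t) f² - ∫ f'²)² / ∫ f⁴)` as soon as the right side is nonnegative.

Ignoring `∫ f'²`, Cauchy–Schwarz makes `f² = (a - t)₊` optimal: both integrals equal `a³/3`, and the
exponent is `-β a³/24`. This `f` is not admissible: it does not vanish at `0`, and `f'²` is not
integrable at `a`. `testFun` repairs both defects, by the minimum with `t` and by the shift `√(a - t
+ 1) - 1`. Then `∫ f'² ≤ a` and `∫ f⁴ ≤ a³/3`, while `∫ (a - t) f²` loses only `O(a^(5/2))`; all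
errors go into `ε`.

The noise term is the path integral `-∫ (f²)' b`. Its Gaussian tail
(`IsBrownianReal.measure_neg_integral_deriv_mul_gt_le`) comes from summation by parts, which
approximates it by weighted sums of independent Brownian increments. -/

/-! ### Gaussian tails of Wiener integrals. -/

/-- Generalized Riemann sums over the uniform partition of `[0, T]`, with the weight of each cell
given by the integral of `g` over it, converge to the integral of `h * g`. -/
theorem tendsto_sum_mul_integral_partition {T : ℝ} (hT : 0 < T) {h g : ℝ → ℝ}
    (hh : ContinuousOn h (Set.Icc 0 T)) (hg : IntervalIntegrable g volume 0 T)
    (τ : ℕ → ℕ → ℝ)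
    (hτ : ∀ n i : ℕ, i < n → τ n i ∈ Set.Icc ((i : ℝ) * (T / n)) ((i + 1 : ℕ) * (T / n))) :
    Tendsto (fun n : ℕ => ∑ i ∈ Finset.range n,
        h (τ n i) * ∫ t in (i * (T / n))..((i + 1 : ℕ) * (T / n)), g t)
      atTop (𝓝 (∫ t in (0 : ℝ)..T, h t * g t)) := by
  have huc : UniformContinuousOn h (Set.Icc 0 T) :=
    isCompact_Icc.uniformContinuousOn_of_continuous hh
  have hhg : IntervalIntegrable (fun t => h t * g t) volume 0 T := by
    refine hg.continuousOn_mul ?_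
    rwa [Set.uIcc_of_le hT.le]
  have hI0 : 0 ≤ ∫ t in (0 : ℝ)..T, |g t| :=
    intervalIntegral.integral_nonneg hT.le fun _ _ => abs_nonneg _
  rw [Metric.tendsto_atTop]
  intro ε hε
  set J := ∫ t in (0 : ℝ)..T, |g t| with hJ
  -- The `+ 1` covers `J = 0`; the factor `2` leaves room for the final strict inequality.
  obtain ⟨δ, hδ, hhδ⟩ := Metric.uniformContinuousOn_iff.1 huc (ε / (2 * (J + 1))) (by positivity)
  obtain ⟨N, hN⟩ := exists_nat_gt (T / δ)
  refine ⟨N + 1, fun n hn => ?_⟩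
  have hn0 : (0 : ℝ) < n := by exact_mod_cast (by omega : 0 < n)
  have hmesh : T / n < δ := by
    have : (N : ℝ) ≤ n := by exact_mod_cast (by omega : N ≤ n)
    rw [div_lt_iff₀ hδ] at hN
    rw [div_lt_iff₀ hn0]
    nlinarith
  have hmesh0 : 0 < T / n := by positivity
  have hend : (n : ℝ) * (T / n) = T := by field_simp
  have hle : ∀ i : ℕ, (i : ℝ) * (T / n) ≤ ((i + 1 : ℕ) : ℝ) * (T / n) := fun i => by
    push_cast; nlinarith
  have hup : ∀ i < n, ((i + 1 : ℕ) : ℝ) * (T / n) ≤ T := fun i hi => by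
    calc ((i + 1 : ℕ) : ℝ) * (T / n) ≤ n * (T / n) := by gcongr; exact hi
      _ = T := hend
  have hsub : ∀ i < n, Set.uIcc ((i : ℝ) * (T / n)) ((i + 1 : ℕ) * (T / n)) ⊆ Set.uIcc 0 T :=
    fun i hi => by
      rw [Set.uIcc_of_le (hle i), Set.uIcc_of_le hT.le]
      exact Set.Icc_subset_Icc (by positivity) (hup i hi)
  have hgi : ∀ i < n, IntervalIntegrable g volume (i * (T / n)) ((i + 1 : ℕ) * (T / n)) :=
    fun i hi => hg.mono_set (hsub i hi)
  have hhgi : ∀ i < n, IntervalIntegrable (fun t => h t * g t) volume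
      (i * (T / n)) ((i + 1 : ℕ) * (T / n)) := fun i hi => hhg.mono_set (hsub i hi)
  have hsplit : ∀ {u : ℝ → ℝ}, (∀ i < n, IntervalIntegrable u volume
      (i * (T / n)) ((i + 1 : ℕ) * (T / n))) → ∑ i ∈ Finset.range n,
        ∫ t in (i * (T / n))..((i + 1 : ℕ) * (T / n)), u t = ∫ t in (0 : ℝ)..T, u t := by
    intro u hu
    have := intervalIntegral.sum_integral_adjacent_intervals
      (a := fun i : ℕ => (i : ℝ) * (T / n)) (n := n) hu
    simpa [hend] using this
  rw [Real.dist_eq, ← hsplit hhgi, ← Finset.sum_sub_distrib]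
  calc |∑ i ∈ Finset.range n, (h (τ n i) * (∫ t in (i * (T / n))..((i + 1 : ℕ) * (T / n)), g t)
          - ∫ t in (i * (T / n))..((i + 1 : ℕ) * (T / n)), h t * g t)|
      ≤ ∑ i ∈ Finset.range n, ε / (2 * (J + 1)) *
          ∫ t in (i * (T / n))..((i + 1 : ℕ) * (T / n)), |g t| := by
        refine (Finset.abs_sum_le_sum_abs _ _).trans (Finset.sum_le_sum fun i hi => ?_)
        have hi' := Finset.mem_range.1 hi
        rw [← intervalIntegral.integral_const_mul, ← intervalIntegral.integral_sub
          ((hgi i hi').const_mul _) (hhgi i hi'), ← intervalIntegral.integral_const_mul,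
          ← Real.norm_eq_abs]
        refine intervalIntegral.norm_integral_le_of_norm_le (hle i) ?_ ((hgi i hi').abs.const_mul _)
        refine ae_of_all _ fun t ht => ?_
        rw [← sub_mul, norm_mul, Real.norm_eq_abs, Real.norm_eq_abs]
        refine mul_le_mul_of_nonneg_right ?_ (abs_nonneg _)
        have h1 := hτ n i hi'
        have h0 : 0 ≤ (i : ℝ) * (T / n) := by positivity
        have h2 := hup i hi'
        refine (hhδ _ ⟨h0.trans h1.1, h1.2.trans h2⟩ t ⟨h0.trans ht.1.le, ht.2.trans h2⟩ ?_).le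
        have h3 : ((i + 1 : ℕ) : ℝ) * (T / n) = i * (T / n) + T / n := by push_cast; ring
        rw [Real.dist_eq, abs_lt]
        constructor <;> linarith [h1.1, h1.2, ht.1, ht.2]
    _ = ε / (2 * (J + 1)) * J := by
        rw [← Finset.mul_sum, hsplit fun i hi => (hgi i hi).abs]
    _ < ε := by
        rw [div_mul_eq_mul_div, div_lt_iff₀ (by positivity)]
        nlinarith

/-- If almost every point of `s` belongs to `S n` for all large `n`, then a limit of upper bounds
for the measures of the sets `S n` is an upper bound for the measure of `s`. -/
theorem measureReal_le_of_ae_eventually_mem {Ω : Type*} [MeasurableSpace Ω] {P : Measure Ω}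
    [IsFiniteMeasure P] {s : Set Ω} {S : ℕ → Set Ω} {u : ℕ → ℝ} {L : ℝ}
    (hs : ∀ᵐ ω ∂P, ω ∈ s → ∀ᶠ n in atTop, ω ∈ S n)
    (hS : ∀ᶠ n in atTop, P.real (S n) ≤ u n) (hu : Tendsto u atTop (𝓝 L)) :
    P.real s ≤ L := by
  have hL : 0 ≤ L := ge_of_tendsto hu (hS.mono fun n hn => measureReal_nonneg.trans hn)
  have hmono : Monotone fun n => ⋂ m ≥ n, S m := by
    intro m n hmn
    exact Set.biInter_mono (fun k hk => le_trans hmn hk) fun _ _ => le_rfl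
  have hle : P s ≤ P (⋃ n, ⋂ m ≥ n, S m) := by
    refine measure_mono_ae ?_
    filter_upwards [hs] with ω hω hωs
    obtain ⟨n, hn⟩ := eventually_atTop.1 (hω hωs)
    exact Set.mem_iUnion.2 ⟨n, Set.mem_iInter₂.2 hn⟩
  refine ENNReal.toReal_le_of_le_ofReal hL (hle.trans ?_)
  -- Continuity from below along a monotone union holds for arbitrary sets, so the eigenvalue event
  -- need not be shown measurable.
  rw [hmono.measure_iUnion]
  refine iSup_le fun n => ?_
  have : P.real (⋂ m ≥ n, S m) ≤ L := by
    refine ge_of_tendsto hu ?_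
    filter_upwards [hS, eventually_ge_atTop n] with k hk hkn
    exact (measureReal_mono (Set.biInter_subset_of_mem hkn)).trans hk
  exact (ENNReal.le_ofReal_iff_toReal_le (measure_ne_top _ _) hL).2 this

theorem hasSubgaussianMGF_of_hasLaw_gaussianReal {Ω : Type*} [MeasurableSpace Ω] {P : Measure Ω}
    {X : Ω → ℝ} {v : ℝ≥0} (hX : HasLaw X (gaussianReal 0 v) P) : HasSubgaussianMGF X v P where
  integrable_exp_mul t := by
    have := integrable_exp_mul_gaussianReal (μ := 0) (v := v) t
    rw [← hX.map_eq] at this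
    exact this.comp_aemeasurable hX.aemeasurable
  mgf_le t := by
    rw [mgf_gaussianReal hX.map_eq]
    simp

/-- The tail of a discrete Wiener integral `∑ w i (b (t (i + 1)) - b (t i))`. -/
theorem IsPreBrownianReal.measure_sum_mul_increments_ge_le {Ω : Type*} [MeasurableSpace Ω]
    {P : Measure Ω} {b : ℝ≥0 → Ω → ℝ} (hb : IsPreBrownianReal b P)
    {t : ℕ → ℝ≥0} (ht : Monotone t) (w : ℕ → ℝ) (n : ℕ) {c : ℝ} (hc : 0 ≤ c) :
    P.real {ω | c ≤ ∑ i ∈ Finset.range n, w i * (b (t (i + 1)) ω - b (t i) ω)} ≤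
      Real.exp (-c ^ 2 / (2 * ∑ i ∈ Finset.range n, w i ^ 2 * ((t (i + 1) : ℝ) - t i))) := by
  have hind : iIndepFun (fun i ω => w i * (b (t (i + 1)) ω - b (t i) ω)) P :=
    (hb.hasIndepIncrements.nat ht).comp (fun i x => w i * x) fun i => measurable_const_mul _
  have hsub : ∀ i ∈ Finset.range n,
      HasSubgaussianMGF (fun ω => w i * (b (t (i + 1)) ω - b (t i) ω))
        ((w i ^ 2).toNNReal * nndist (t (i + 1) : ℝ) (t i)) P := fun i _ => by
    have h := (hasSubgaussianMGF_of_hasLaw_gaussianReal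
      (hb.hasLaw_sub (t (i + 1)) (t i))).const_mul (w i)
    rw [Real.toNNReal_of_nonneg (sq_nonneg _)]
    exact h
  refine (HasSubgaussianMGF.measure_sum_ge_le_of_iIndepFun hind hsub hc).trans_eq ?_
  congr 3
  push_cast
  refine Finset.sum_congr rfl fun i _ => ?_
  rw [Real.coe_toNNReal _ (sq_nonneg _), Real.dist_eq,
    abs_of_nonneg (sub_nonneg.2 (NNReal.coe_le_coe.2 (ht i.le_succ)))]

/-- The Gaussian tail of the integral `∫₀ᵀ F db = -∫₀ᵀ F' b`, where `F` vanishes at `0` and `T`. -/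
theorem IsBrownianReal.measure_neg_integral_deriv_mul_gt_le {Ω : Type*} [MeasurableSpace Ω]
    {P : Measure Ω} [IsProbabilityMeasure P] {b : ℝ≥0 → Ω → ℝ} (hb : IsBrownianReal b P)
    {T : ℝ} (hT : 0 < T) {F g : ℝ → ℝ} (hF : ContinuousOn F (Set.Icc 0 T)) (hF0 : F 0 = 0)
    (hFT : F T = 0) (hg : IntervalIntegrable g volume 0 T)
    (hFg : ∀ x ∈ Set.Icc 0 T, ∀ y ∈ Set.Icc 0 T, ∫ t in x..y, g t = F y - F x)
    (hV : 0 < ∫ t in (0 : ℝ)..T, F t ^ 2) {c : ℝ} (hc : 0 ≤ c) :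
    P.real {ω | c < -∫ t in (0 : ℝ)..T, g t * b t.toNNReal ω} ≤
      Real.exp (-c ^ 2 / (2 * ∫ t in (0 : ℝ)..T, F t ^ 2)) := by
  let t : ℕ → ℕ → ℝ≥0 := fun n i => i * (T.toNNReal / n)
  have htc : ∀ n i : ℕ, ((t n i : ℝ≥0) : ℝ) = i * (T / n) := fun n i => by
    simp [t, hT.le]
  have htmono : ∀ n, Monotone (t n) := fun n i j hij => by
    simp only [t]; gcongr
  have htmem : ∀ n i : ℕ, i ≤ n → (i : ℝ) * (T / n) ∈ Set.Icc 0 T := by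
    intro n i hi
    refine ⟨by positivity, ?_⟩
    rcases Nat.eq_zero_or_pos n with rfl | hn
    · simpa using hT.le
    · have : (0 : ℝ) < n := by exact_mod_cast hn
      calc (i : ℝ) * (T / n) ≤ n * (T / n) := by gcongr
        _ = T := by field_simp
  have hv := tendsto_sum_mul_integral_partition hT (hF.pow 2)
    (intervalIntegrable_const (c := (1 : ℝ))) (fun n i => i * (T / n)) fun n i _ =>
      ⟨le_rfl, by push_cast; nlinarith [div_nonneg hT.le (Nat.cast_nonneg (α := ℝ) n)]⟩
  simp only [mul_one] at hv
  refine measureReal_le_of_ae_eventually_mem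
    (S := fun n => {ω | c ≤ ∑ i ∈ Finset.range n, F (i * (T / n)) *
      (b (t n (i + 1)) ω - b (t n i) ω)}) ?_ (Eventually.of_forall fun n =>
      IsPreBrownianReal.measure_sum_mul_increments_ge_le hb.toIsPreBrownianReal (htmono n) _ n hc) ?_
  · filter_upwards [hb.cont] with ω hω hcω
    have hcont : ContinuousOn (fun s : ℝ => b s.toNNReal ω) (Set.Icc 0 T) :=
      (hω.comp continuous_real_toNNReal).continuousOn
    -- Abel summation pairs `F` at left endpoints with `b` at right endpoints; the boundary terms
    -- vanish with `F 0` and `F T`.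
    have hlim := (tendsto_sum_mul_integral_partition hT hcont hg
      (fun n i => ((i + 1 : ℕ) : ℝ) * (T / n)) fun n i _ =>
      ⟨by push_cast; nlinarith [div_nonneg hT.le (Nat.cast_nonneg (α := ℝ) n)], le_rfl⟩).neg
    have hcω' : c < -∫ t in (0 : ℝ)..T, b t.toNNReal ω * g t := by
      simpa only [mul_comm] using hcω
    -- Strictness of `c < …` lets the inequality pass from the limit to all fine partitions.
    filter_upwards [hlim.eventually (lt_mem_nhds hcω'), eventually_gt_atTop 0] with n hn hn0
    refine hn.le.trans_eq ?_
    rw [neg_eq_iff_add_eq_zero, ← Finset.sum_add_distrib]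
    have htele := Finset.sum_range_sub (fun i : ℕ => F (i * (T / n)) * b (t n i) ω) n
    have hn1 : (n : ℝ) * (T / n) = T := by
      have : (0 : ℝ) < n := by exact_mod_cast hn0
      field_simp
    simp only [hn1, hFT, Nat.cast_zero, zero_mul, hF0, sub_zero] at htele
    rw [← htele]
    refine Finset.sum_congr rfl fun i hi => ?_
    have hi' := Finset.mem_range.1 hi
    rw [hFg _ (htmem n i hi'.le) _ (htmem n (i + 1) hi'), ← htc n (i + 1), Real.toNNReal_coe]
    ring
  · have hv' : Tendsto (fun n : ℕ => ∑ i ∈ Finset.range n,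
        F (i * (T / n)) ^ 2 * ((t n (i + 1) : ℝ) - t n i)) atTop
        (𝓝 (∫ t in (0 : ℝ)..T, F t ^ 2)) := by
      simpa [htc] using hv
    exact (Real.continuous_exp.tendsto _).comp
      (tendsto_const_nhds.div (hv'.const_mul 2) (by positivity))

/-! ### The test function and its integrals. -/

namespace StochasticAiry

/-- A test function that is close to `√(a - t)` on `[0, a]`, with slope at most `1`. -/
noncomputable def testFun (a t : ℝ) : ℝ := max 0 (min t (√(max (a - t) 0 + 1) - 1))

variable {a t : ℝ}

theorem testFun_nonneg : 0 ≤ testFun a t := le_max_left _ _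

theorem testFun_of_nonpos (ht : t ≤ 0) : testFun a t = 0 :=
  max_eq_left ((min_le_left _ _).trans ht)

theorem testFun_of_le (ht : a ≤ t) : testFun a t = 0 := by
  refine max_eq_left ((min_le_right _ _).trans ?_)
  rw [max_eq_right (by linarith)]
  simp

theorem testFun_pos (h0 : 0 < t) (h1 : t < a) : 0 < testFun a t := by
  refine lt_max_of_lt_right (lt_min h0 ?_)
  rw [sub_pos, max_eq_left (by linarith)]
  exact Real.lt_sqrt_of_sq_lt (by linarith)

theorem one_le_sqrt_max_add_one (x : ℝ) : 1 ≤ √(max x 0 + 1) :=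
  Real.one_le_sqrt.2 (by linarith [le_max_right x 0])

theorem testFun_sq_le : testFun a t ^ 2 ≤ max (a - t) 0 := by
  have h1 := one_le_sqrt_max_add_one (a - t)
  have h2 : testFun a t ≤ √(max (a - t) 0 + 1) - 1 :=
    max_le (by linarith) (min_le_right _ _)
  have h3 : √(max (a - t) 0 + 1) ^ 2 = max (a - t) 0 + 1 :=
    Real.sq_sqrt (by positivity)
  have h4 : testFun a t ^ 2 ≤ (√(max (a - t) 0 + 1) - 1) ^ 2 :=
    pow_le_pow_left₀ testFun_nonneg h2 2
  nlinarith

/-- Beyond `√(a + 1)` the minimum is the square-root branch, whose square is `a - t + 2 - 2√(a - t +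
1)`. -/
theorem le_testFun_sq (h0 : √(a + 1) ≤ t) (h1 : t ≤ a) :
    a - t - 2 * √(a + 1) ≤ testFun a t ^ 2 := by
  have ht : 0 ≤ t := (Real.sqrt_nonneg _).trans h0
  have h2 : √(a - t + 1) ≤ √(a + 1) := Real.sqrt_le_sqrt (by linarith)
  have h3 : testFun a t = √(a - t + 1) - 1 := by
    have := one_le_sqrt_max_add_one (a - t)
    rw [max_eq_left (by linarith)] at this
    rw [testFun, max_eq_left (by linarith : 0 ≤ a - t), min_eq_right (by linarith),
      max_eq_right (by linarith)]
  rw [h3]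
  nlinarith [Real.sq_sqrt (by linarith : 0 ≤ a - t + 1)]

/-- The shift keeps both square roots at least `1`, so dividing by their sum costs nothing. -/
theorem lipschitzWith_testFun (a : ℝ) : LipschitzWith 1 (testFun a) := by
  refine LipschitzWith.of_dist_le_mul fun x y => ?_
  rw [NNReal.coe_one, one_mul, Real.dist_eq, Real.dist_eq]
  have h1 := one_le_sqrt_max_add_one (a - x)
  have h2 := one_le_sqrt_max_add_one (a - y)
  have h3 : |√(max (a - x) 0 + 1) - √(max (a - y) 0 + 1)| ≤ |x - y| := by
    have h4 : (√(max (a - x) 0 + 1) - √(max (a - y) 0 + 1)) *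
        (√(max (a - x) 0 + 1) + √(max (a - y) 0 + 1)) = max (a - x) 0 - max (a - y) 0 := by
      have e1 := Real.sq_sqrt (by positivity : 0 ≤ max (a - x) 0 + 1)
      have e2 := Real.sq_sqrt (by positivity : 0 ≤ max (a - y) 0 + 1)
      linear_combination e1 - e2
    calc |√(max (a - x) 0 + 1) - √(max (a - y) 0 + 1)|
        ≤ |√(max (a - x) 0 + 1) - √(max (a - y) 0 + 1)| *
          |√(max (a - x) 0 + 1) + √(max (a - y) 0 + 1)| := by
          refine le_mul_of_one_le_right (abs_nonneg _) ?_
          rw [abs_of_nonneg (by positivity)]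
          linarith
      _ = |max (a - x) 0 - max (a - y) 0| := by rw [← abs_mul, h4]
      _ ≤ |(a - x) - (a - y)| := abs_max_sub_max_le_abs _ _ _
      _ = |x - y| := by rw [← abs_neg]; ring_nf
  calc |testFun a x - testFun a y|
      ≤ |min x (√(max (a - x) 0 + 1) - 1) - min y (√(max (a - y) 0 + 1) - 1)| := by
        unfold testFun
        rw [max_comm 0, max_comm 0]
        exact abs_max_sub_max_le_abs _ _ _
    _ ≤ max |x - y| |(√(max (a - x) 0 + 1) - 1) - (√(max (a - y) 0 + 1) - 1)| :=
        abs_min_sub_min_le_max _ _ _ _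
    _ ≤ |x - y| := by
        rw [sub_sub_sub_cancel_right]
        exact max_le le_rfl h3

theorem continuous_testFun (a : ℝ) : Continuous (testFun a) := (lipschitzWith_testFun a).continuous

theorem absolutelyContinuousOnInterval_testFun (a x y : ℝ) :
    AbsolutelyContinuousOnInterval (testFun a) x y :=
  (lipschitzWith_testFun a).lipschitzOnWith.absolutelyContinuousOnInterval

theorem deriv_testFun_sq_le :
    deriv (testFun a) t ^ 2 ≤ (Set.Ioc 0 a).indicator (fun _ => (1 : ℝ)) t := by
  by_cases ht : t ∈ Set.Ioc 0 a
  · rw [Set.indicator_of_mem ht]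
    have := norm_deriv_le_of_lipschitz (lipschitzWith_testFun a) (x₀ := t)
    rw [NNReal.coe_one, Real.norm_eq_abs] at this
    exact (sq_le_one_iff_abs_le_one _).2 this
  · rw [Set.indicator_of_notMem ht]
    suffices h : deriv (testFun a) t = 0 by simp [h]
    rcases le_or_gt t 0 with h0 | h0
    -- Wherever the nonnegative function vanishes it has a minimum, which also settles the corners,
    -- where `deriv` may be a default `0`.
    · exact (IsMinOn.isLocalMin (s := Set.univ) (fun x _ => by
        simpa [testFun_of_nonpos h0] using testFun_nonneg) univ_mem).deriv_eq_zero
    · have h1 : a ≤ t := by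
        by_contra! h
        exact ht ⟨h0, h.le⟩
      exact (IsMinOn.isLocalMin (s := Set.univ) (fun x _ => by
        simpa [testFun_of_le h1] using testFun_nonneg) univ_mem).deriv_eq_zero

theorem integrableOn_indicator_Ioc_one (a : ℝ) :
    Integrable ((Set.Ioc 0 a).indicator fun _ => (1 : ℝ)) (volume.restrict (Set.Ioi 0)) :=
  ((integrable_indicator_iff measurableSet_Ioc).2 (by simp)).restrict

theorem integral_deriv_testFun_sq_le (ha : 0 < a) :
    ∫ t in Set.Ioi (0 : ℝ), deriv (testFun a) t ^ 2 ≤ a := by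
  calc ∫ t in Set.Ioi (0 : ℝ), deriv (testFun a) t ^ 2
      ≤ ∫ t in Set.Ioi (0 : ℝ), (Set.Ioc 0 a).indicator (fun _ => (1 : ℝ)) t :=
        integral_mono_of_nonneg (ae_of_all _ fun _ => sq_nonneg _)
          (integrableOn_indicator_Ioc_one a) (ae_of_all _ fun _ => deriv_testFun_sq_le)
    _ = a := by
        rw [setIntegral_indicator measurableSet_Ioc,
          Set.inter_eq_self_of_subset_right Set.Ioc_subset_Ioi_self]
        simp [ha.le]

theorem hasCompactSupport_testFun (a : ℝ) : HasCompactSupport (testFun a) := by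
  refine HasCompactSupport.intro (isCompact_Icc (a := 0) (b := a)) fun x hx => ?_
  rcases le_or_gt x 0 with h0 | h0
  · exact testFun_of_nonpos h0
  · refine testFun_of_le ?_
    by_contra! h
    exact hx ⟨h0.le, h.le⟩

theorem formDomain_testFun (a : ℝ) : FormDomain (testFun a) where
  eq_zero _ ht := testFun_of_nonpos ht
  absCont R _ := absolutelyContinuousOnInterval_testFun a 0 R
  memLp := ((continuous_testFun a).memLp_of_hasCompactSupport
    (hasCompactSupport_testFun a)).restrict _
  memLp_deriv := by
    rw [memLp_two_iff_integrable_sq (measurable_deriv _).aestronglyMeasurable]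
    refine (integrableOn_indicator_Ioc_one a).mono'
      ((measurable_deriv _).pow_const 2).aestronglyMeasurable (ae_of_all _ fun t => ?_)
    rw [Real.norm_of_nonneg (sq_nonneg _)]
    exact deriv_testFun_sq_le
  memLp_sqrt := ((Real.continuous_sqrt.mul (continuous_testFun a)).memLp_of_hasCompactSupport
    (hasCompactSupport_testFun a).mul_left).restrict _

/-- Integrals over the half-line of functions that vanish beyond `a`. -/
theorem setIntegral_Ioi_eq_intervalIntegral {h : ℝ → ℝ} (ha : 0 ≤ a) (hh : ∀ t, a ≤ t → h t = 0) :
    ∫ t in Set.Ioi (0 : ℝ), h t = ∫ t in (0 : ℝ)..a, h t := by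
  rw [intervalIntegral.integral_of_le ha]
  refine setIntegral_eq_of_subset_of_forall_sdiff_eq_zero measurableSet_Ioi
    Set.Ioc_subset_Ioi_self fun t ht => hh t ?_
  by_contra! h
  exact ht.2 ⟨ht.1, h.le⟩

theorem integral_testFun_pow_four_le (ha : 0 < a) :
    ∫ t in (0 : ℝ)..a, (testFun a t ^ 2) ^ 2 ≤ a ^ 3 / 3 := by
  have hc := continuous_testFun a
  calc ∫ t in (0 : ℝ)..a, (testFun a t ^ 2) ^ 2
      ≤ ∫ t in (0 : ℝ)..a, (a - t) ^ 2 := by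
        refine intervalIntegral.integral_mono_on ha.le
          (Continuous.intervalIntegrable (by fun_prop) _ _)
          (Continuous.intervalIntegrable (by fun_prop) _ _) fun t ht => ?_
        have := testFun_sq_le (a := a) (t := t)
        rw [max_eq_left (by linarith [ht.2])] at this
        exact pow_le_pow_left₀ (sq_nonneg _) this 2
    _ = a ^ 3 / 3 := by
        rw [intervalIntegral.integral_comp_sub_left (fun x => x ^ 2), integral_pow]
        norm_num

theorem integral_testFun_pow_four_pos (ha : 0 < a) :
    0 < ∫ t in (0 : ℝ)..a, (testFun a t ^ 2) ^ 2 := by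
  have hc := continuous_testFun a
  exact intervalIntegral.intervalIntegral_pos_of_pos_on
    (Continuous.intervalIntegrable (by fun_prop) _ _)
    (fun t ht => pow_pos (pow_pos (testFun_pos ht.1 ht.2) 2) 2) ha

/-- The nonnegative contribution of `[0, √(a + 1)]` is dropped; on the rest `le_testFun_sq` is
integrated. -/
theorem le_integral_sub_mul_testFun_sq (ha : √(a + 1) ≤ a) :
    (a - √(a + 1)) ^ 3 / 3 - √(a + 1) * (a - √(a + 1)) ^ 2 ≤
      ∫ t in (0 : ℝ)..a, (a - t) * testFun a t ^ 2 := by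
  have hc := continuous_testFun a
  set s := √(a + 1) with hs
  have hs0 : 0 ≤ s := Real.sqrt_nonneg _
  have hint : ∀ x y, IntervalIntegrable (fun t => (a - t) * testFun a t ^ 2) volume x y :=
    fun x y => Continuous.intervalIntegrable (by fun_prop) _ _
  have h1 : 0 ≤ ∫ t in (0 : ℝ)..s, (a - t) * testFun a t ^ 2 :=
    intervalIntegral.integral_nonneg hs0 fun t ht =>
      mul_nonneg (by linarith [ht.2]) (sq_nonneg _)
  have h2 : ∫ t in s..a, ((a - t) ^ 2 - 2 * s * (a - t)) ≤
      ∫ t in s..a, (a - t) * testFun a t ^ 2 := by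
    refine intervalIntegral.integral_mono_on ha
      (Continuous.intervalIntegrable (by fun_prop) _ _) (hint _ _) fun t ht => ?_
    have := mul_le_mul_of_nonneg_left (le_testFun_sq ht.1 ht.2) (by linarith [ht.2] : 0 ≤ a - t)
    linarith
  have h3 : ∫ t in s..a, ((a - t) ^ 2 - 2 * s * (a - t)) =
      (a - s) ^ 3 / 3 - s * (a - s) ^ 2 := by
    rw [intervalIntegral.integral_comp_sub_left (fun x => x ^ 2 - 2 * s * x),
      intervalIntegral.integral_sub (Continuous.intervalIntegrable (by fun_prop) _ _)
        (Continuous.intervalIntegrable (by fun_prop) _ _),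
      intervalIntegral.integral_const_mul, integral_pow, integral_id]
    norm_num
    ring
  rw [← intervalIntegral.integral_add_adjacent_intervals (hint 0 s) (hint s a)]
  linarith

/-! ### The variational bound. -/

theorem FormDomain.const_smul {f : ℝ → ℝ} (hf : FormDomain f) (c : ℝ) : FormDomain (c • f) where
  eq_zero t ht := by simp [hf.eq_zero t ht]
  absCont R hR := (hf.absCont R hR).const_smul c
  memLp := hf.memLp.const_smul c
  memLp_deriv := by
    rw [show deriv (c • f) = c • deriv f from funext fun t => deriv_const_smul_field c f]
    exact hf.memLp_deriv.const_smul c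
  memLp_sqrt := by
    convert hf.memLp_sqrt.const_smul c using 1
    ext t
    simp only [Pi.smul_apply, smul_eq_mul]
    ring

theorem noiseForm_eq_of_forall_le (b : ℝ≥0 → ℝ) {f : ℝ → ℝ} {T : ℝ} (hT : 0 ≤ T)
    (hf : ∀ t, T ≤ t → f t = 0) :
    noiseForm b f = -∫ t in (0 : ℝ)..T, 2 * f t * deriv f t * b t.toNNReal := by
  refine Tendsto.limUnder_eq (tendsto_const_nhds.congr' ?_)
  filter_upwards [eventually_ge_atTop T] with R hR
  rw [noiseIntegralUpTo, hf R hR, intervalIntegral.integral_of_le hT,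
    intervalIntegral.integral_of_le (hT.trans hR)]
  rw [setIntegral_eq_of_subset_of_forall_sdiff_eq_zero (s := Set.Ioc 0 T) (t := Set.Ioc 0 R)
    measurableSet_Ioc (Set.Ioc_subset_Ioc_right hR)]
  · ring
  · intro t ht
    have : T ≤ t := by
      by_contra! h
      exact ht.2 ⟨ht.1.1, h.le⟩
    simp [hf t this]

theorem normSq_smul (c : ℝ) (f : ℝ → ℝ) : normSq (c • f) = c ^ 2 * normSq f := by
  simp only [normSq, Pi.smul_apply, smul_eq_mul, mul_pow, integral_const_mul]

theorem saoForm_smul (β : ℝ) (b : ℝ≥0 → ℝ) {f : ℝ → ℝ} {T : ℝ} (hT : 0 ≤ T)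
    (hf : ∀ t, T ≤ t → f t = 0) (c : ℝ) : saoForm β b (c • f) = c ^ 2 * saoForm β b f := by
  have hd : ∀ t, deriv (c • f) t = c * deriv f t := fun t => deriv_const_smul_field c f
  have h1 : ∀ t, t * (c ^ 2 * f t ^ 2) = c ^ 2 * (t * f t ^ 2) := fun t => by ring
  have h2 : ∀ t, 2 * (c * f t) * (c * deriv f t) * b t.toNNReal =
      c ^ 2 * (2 * f t * deriv f t * b t.toNNReal) := fun t => by ring
  rw [saoForm, saoForm, noiseForm_eq_of_forall_le b hT hf,
    noiseForm_eq_of_forall_le b hT fun t ht => by simp [hf t ht]]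
  simp only [hd, Pi.smul_apply, smul_eq_mul, h2, mul_pow, h1, integral_const_mul,
    intervalIntegral.integral_const_mul]
  ring

/-- The variational bound for the bottom eigenvalue, for a compactly supported test function. -/
theorem mul_normSq_lt_saoForm {β : ℝ} {b : ℝ≥0 → ℝ} {f : ℝ → ℝ} {T a : ℝ} (hT : 0 ≤ T)
    (hf : FormDomain f) (hfT : ∀ t, T ≤ t → f t = 0) (hf0 : f ≠ 0)
    (h : (a : EReal) < eigenvalue β b 0) : a * normSq f < saoForm β b f := by
  have hle : eigenvalue β b 0 ≤ ⨆ (g : ℝ → ℝ) (_ : g ∈ Submodule.span ℝ {f})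
      (_ : normSq g = 1), (saoForm β b g : EReal) := by
    refine iInf_le_of_le (Submodule.span ℝ {f}) (iInf₂_le_of_le ?_ ?_ le_rfl)
    · simpa using finrank_span_singleton hf0
    · intro g hg
      obtain ⟨c, rfl⟩ := Submodule.mem_span_singleton.1 hg
      exact hf.const_smul c
  have hlt := h.trans_le hle
  simp only [lt_iSup_iff] at hlt
  obtain ⟨g, hg, hg1, hag⟩ := hlt
  obtain ⟨c, rfl⟩ := Submodule.mem_span_singleton.1 hg
  rw [normSq_smul] at hg1
  rw [saoForm_smul β b hT hfT, EReal.coe_lt_coe_iff] at hag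
  -- Positivity is forced by `c ^ 2 * normSq f = 1`.
  have hN : 0 < normSq f := by
    by_contra! hN
    nlinarith [sq_nonneg c]
  calc a * normSq f < c ^ 2 * saoForm β b f * normSq f := mul_lt_mul_of_pos_right hag hN
    _ = saoForm β b f := by linear_combination saoForm β b f * hg1

/-! ### Asymptotics and the tail of the eigenvalue. -/

/-- The lower bound that the test function yields for `∫ (a - t) f² - ∫ f'²`. -/
noncomputable def energyGap (a : ℝ) : ℝ :=
  (a - √(a + 1)) ^ 3 / 3 - √(a + 1) * (a - √(a + 1)) ^ 2 - a

theorem tendsto_energyGap_div : Tendsto (fun a => energyGap a / a ^ 3) atTop (𝓝 (1 / 3)) := by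
  have h1 : Tendsto (fun a : ℝ => a⁻¹) atTop (𝓝 0) := tendsto_inv_atTop_zero
  -- For `a > 0` this root is `√(a + 1) / a`, the relative size of the loss.
  have h2 : Tendsto (fun a : ℝ => √(a⁻¹ + a⁻¹ ^ 2)) atTop (𝓝 0) := by
    have := (h1.add (h1.pow 2)).sqrt
    simpa using this
  have h3 : Tendsto (fun a : ℝ => (1 - √(a⁻¹ + a⁻¹ ^ 2)) ^ 3 / 3
      - √(a⁻¹ + a⁻¹ ^ 2) * (1 - √(a⁻¹ + a⁻¹ ^ 2)) ^ 2 - a⁻¹ ^ 2) atTop (𝓝 (1 / 3)) := by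
    have := ((((h2.const_sub 1).pow 3).div_const 3).sub (h2.mul ((h2.const_sub 1).pow 2))).sub
      (h1.pow 2)
    simpa using this
  refine h3.congr' ?_
  filter_upwards [eventually_gt_atTop 0] with a ha
  have hs : √(a⁻¹ + a⁻¹ ^ 2) = √(a + 1) / a := by
    rw [show a⁻¹ + a⁻¹ ^ 2 = (a + 1) / a ^ 2 by field_simp, Real.sqrt_div' _ (sq_nonneg a),
      Real.sqrt_sq ha.le]
  rw [hs, energyGap]
  field_simp

theorem sqrt_add_one_le {a : ℝ} (ha : 2 ≤ a) : √(a + 1) ≤ a :=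
  Real.sqrt_le_iff.2 ⟨by linarith, by nlinarith⟩

theorem lt_neg_integral_of_lt_eigenvalue {β a : ℝ} (hβ : 0 < β) (ha : 2 ≤ a) {b : ℝ≥0 → ℝ}
    (h : (a : EReal) < eigenvalue β b 0) :
    √β / 2 * energyGap a <
      -∫ t in (0 : ℝ)..a, 2 * testFun a t * deriv (testFun a) t * b t.toNNReal := by
  have ha0 : 0 < a := by linarith
  have hc := continuous_testFun a
  have hz : ∀ t, a ≤ t → testFun a t = 0 := fun t ht => testFun_of_le ht
  have hne : testFun a ≠ 0 := fun h0 =>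
    (testFun_pos (a := a) (t := a / 2) (by linarith) (by linarith)).ne' (congrFun h0 _)
  have hlt := mul_normSq_lt_saoForm ha0.le (formDomain_testFun a) hz hne h
  rw [saoForm, noiseForm_eq_of_forall_le b ha0.le hz, normSq,
    setIntegral_Ioi_eq_intervalIntegral ha0.le fun t ht => by simp [hz t ht],
    setIntegral_Ioi_eq_intervalIntegral (h := fun t => t * testFun a t ^ 2) ha0.le
      fun t ht => by simp [hz t ht]] at hlt
  have h1 := integral_deriv_testFun_sq_le ha0
  have h2 := le_integral_sub_mul_testFun_sq (sqrt_add_one_le ha)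
  have h3 : ∫ t in (0 : ℝ)..a, (a - t) * testFun a t ^ 2 =
      a * (∫ t in (0 : ℝ)..a, testFun a t ^ 2) - ∫ t in (0 : ℝ)..a, t * testFun a t ^ 2 := by
    rw [← intervalIntegral.integral_const_mul, ← intervalIntegral.integral_sub
      (Continuous.intervalIntegrable (by fun_prop) _ _)
      (Continuous.intervalIntegrable (by fun_prop) _ _)]
    exact intervalIntegral.integral_congr fun t _ => by ring
  have hsβ : 0 < √β := Real.sqrt_pos.2 hβ
  have h4 : energyGap a < 2 / √β *
      -∫ t in (0 : ℝ)..a, 2 * testFun a t * deriv (testFun a) t * b t.toNNReal := by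
    rw [energyGap]
    linarith
  calc √β / 2 * energyGap a < √β / 2 * (2 / √β *
      -∫ t in (0 : ℝ)..a, 2 * testFun a t * deriv (testFun a) t * b t.toNNReal) :=
        mul_lt_mul_of_pos_left h4 (by positivity)
    _ = _ := by field_simp

theorem measure_lt_eigenvalue_le {Ω : Type*} [MeasurableSpace Ω] {P : Measure Ω}
    [IsProbabilityMeasure P] {b : ℝ≥0 → Ω → ℝ} (hb : IsBrownianReal b P) {β a : ℝ} (hβ : 0 < β)
    (ha : 2 ≤ a) (hgap : 0 ≤ energyGap a) :
    P.real {ω | (a : EReal) < eigenvalue β (fun t => b t ω) 0} ≤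
      Real.exp (-(β / 24) * a ^ 3 * (3 * (energyGap a / a ^ 3)) ^ 2) := by
  have ha0 : 0 < a := by linarith
  have hc := continuous_testFun a
  have hac := fun x y => absolutelyContinuousOnInterval_testFun a x y
  have hV := integral_testFun_pow_four_pos ha0
  have hc0 : 0 ≤ √β / 2 * energyGap a := by positivity
  calc P.real {ω | (a : EReal) < eigenvalue β (fun t => b t ω) 0}
      ≤ P.real {ω | √β / 2 * energyGap a <
        -∫ t in (0 : ℝ)..a, 2 * testFun a t * deriv (testFun a) t * b t.toNNReal ω} :=
        measureReal_mono fun ω hω => lt_neg_integral_of_lt_eigenvalue hβ ha hω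
    _ ≤ Real.exp (-(√β / 2 * energyGap a) ^ 2 /
        (2 * ∫ t in (0 : ℝ)..a, (testFun a t ^ 2) ^ 2)) := by
        refine IsBrownianReal.measure_neg_integral_deriv_mul_gt_le hb ha0
          (F := fun t => testFun a t ^ 2) (by fun_prop) (by simp [testFun_of_nonpos])
          (by simp [testFun_of_le]) ?_ (fun x _ y _ => ?_) hV hc0
        · exact (hac 0 a).intervalIntegrable_deriv.continuousOn_mul
            (continuous_const.mul hc).continuousOn
        · rw [sq, sq, ← (hac x y).integral_deriv_mul_eq_sub (hac x y)]
          exact intervalIntegral.integral_congr fun t _ => by ring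
    _ ≤ Real.exp (-(√β / 2 * energyGap a) ^ 2 / (2 * (a ^ 3 / 3))) := by
        rw [Real.exp_le_exp, neg_div, neg_div, neg_le_neg_iff]
        have := integral_testFun_pow_four_le ha0
        gcongr
    -- With `E = energyGap a`: `(β/4) E² · 3/(2a³) = (β/24) a³ (3E/a³)²`, and `3E/a³ → 1`.
    _ = Real.exp (-(β / 24) * a ^ 3 * (3 * (energyGap a / a ^ 3)) ^ 2) := by
        congr 1
        rw [mul_pow, div_pow, Real.sq_sqrt hβ.le]
        field_simp
        ring

end StochasticAiry

theorem lemmal (β : ℝ) (hβ : 0 < β) :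
    ∃ ε : ℝ → ℝ, Tendsto ε atTop (𝓝 0) ∧
      ∀ (Ω : Type*) [MeasurableSpace Ω] (P : Measure Ω) [IsProbabilityMeasure P]
        (b : ℝ≥0 → Ω → ℝ), IsBrownianReal b P →
        ∀ a : ℝ, 0 < a →
          P.real {ω | (a : EReal) < StochasticAiry.eigenvalue β (fun t => b t ω) 0} ≤
            Real.exp (-(β / 24) * a ^ 3 * (1 + ε a)) := by
  classical
  have hlim := StochasticAiry.tendsto_energyGap_div
  -- The value `-1` turns the bound into `exp 0 = 1`, trivial for the `a` not covered by the
  -- estimate.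
  refine ⟨fun a => if 2 ≤ a ∧ 0 ≤ StochasticAiry.energyGap a then
    (3 * (StochasticAiry.energyGap a / a ^ 3)) ^ 2 - 1 else -1, ?_, ?_⟩
  · have h : Tendsto (fun a => (3 * (StochasticAiry.energyGap a / a ^ 3)) ^ 2 - 1) atTop (𝓝 0) := by
      have := ((hlim.const_mul 3).pow 2).sub_const 1
      norm_num at this
      exact this
    refine h.congr' ?_
    filter_upwards [eventually_ge_atTop 2,
      hlim.eventually (lt_mem_nhds (by norm_num : (0 : ℝ) < 1 / 3))] with a ha hgap
    have ha3 : 0 < a ^ 3 := by positivity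
    rw [if_pos ⟨ha, ((div_pos_iff_of_pos_right ha3).1 hgap).le⟩]
  · intro Ω _ P _ b hb a _
    by_cases h : 2 ≤ a ∧ 0 ≤ StochasticAiry.energyGap a
    · simp only [if_pos h, add_sub_cancel]
      exact StochasticAiry.measure_lt_eigenvalue_le hb hβ h.1 h.2
    · simp only [if_neg h, add_neg_cancel, mul_zero, Real.exp_zero]
      exact measureReal_le_one
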